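/- Let $N\ge 0$ be an even integer and $y\in\mathbb R$. Let $Z_{1,N}=\int_{\mathbb R^N}\prod_{j=1}^N e^{-\lambda_j^2/2}\prod_{1\le j<k\le N}|\lambda_k-\lambda_j|\,d\lambda_1\cdots d\lambda_N$ be the normalisation constant of the GOE eigenvalue density. Let $a$ be a real- or complex-valued measurable function such that $\int_{-\infty}^y |a(x)|\,|x|^k e^{-x^2/2}\,dx<\infty$ for $0\le k\le N-1$, and define the restricted GOE average $$\hat Z_{1,N}[a,y]=\frac1{Z_{1,N}}\int_{-\infty}^y d\lambda_1\cdots\int_{-\infty}^y d\lambda_N\ \prod_{j=1}^N a(\lambda_j)\,e^{-\lambda_j^2/2}\prod_{1\le j<k\le N}|\lambda_k-\lambda_j| .$$ Let $R_0,\dots,R_{N-1}$ be monic real polynomials, $R_j$ of degree $j$, whose coefficients may depend on $y$ (they are otherwise arbitrary; in particular, monic polynomials that are skew-orthogonal with respect to $\langle f,g\rangle_1^y=\frac12\int_{-\infty}^y dx\,e^{-x^2/2}f(x)\int_{-\infty}^y dz\,e^{-z^2/2}g(z)\,\mathrm{sgn}(z-x)$ are covered). Put $$\gamma^{(1)}_{jk}[a,y]=\frac12\int_{-\infty}^y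 dx\ a(x)e^{-x^2/2}R_j(x)\int_{-\infty}^y dz\ a(z)e^{-z^2/2}R_k(z)\,\mathrm{sgn}(z-x),\qquad 0\le j,k\le N-1 .$$ Then $0<Z_{1,N}<\infty$, the integrals defining $\hat Z_{1,N}[a,y]$ and $\gamma^{(1)}_{jk}[a,y]$ converge absolutely, and $$\hat Z_{1,N}[a,y]=\frac{2^{N/2}\,N!}{Z_{1,N}}\ \mathrm{Pf}\,\bigl[\gamma^{(1)}_{jk}[a,y]\bigr]_{j,k=0,\dots,N-1},$$ where, for an antisymmetric matrix $M=[m_{jk}]_{j,k=1,\dots,2n}$, $\mathrm{Pf}\,M=\frac1{2^n n!}\sum_{P\in S_{2n}}\varepsilon(P)\,m_{P(1),P(2)}m_{P(3),P(4)}\cdots m_{P(2n-1),P(2n)}$, with $\varepsilon(P)$ the sign of $P$. -/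

import Mathlib

open MeasureTheory Polynomial

noncomputable section

namespace RestrictedGOE

/-- The Pfaffian of an (antisymmetric) matrix of even size `2n`, indexed from `0`:
`Pf M = 1 / (2^n n!) * ∑_P ε(P) M_{P(0),P(1)} M_{P(2),P(3)} ⋯ M_{P(2n-2),P(2n-1)}`. -/
def pfaffian {𝕜 : Type*} [Field 𝕜] {n : ℕ} (M : Matrix (Fin (2 * n)) (Fin (2 * n)) 𝕜) : 𝕜 :=
  (2 ^ n * (n.factorial : 𝕜))⁻¹ *
    ∑ P : Equiv.Perm (Fin (2 * n)),
      ((Equiv.Perm.sign P : ℤ) : 𝕜) *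
        ∏ i : Fin n, M (P ⟨2 * (i : ℕ), by omega⟩) (P ⟨2 * (i : ℕ) + 1, by omega⟩)

/-- The unnormalised joint eigenvalue density of the GOE:
`∏_j exp (-λ_j² / 2) * ∏_{j < k} |λ_k - λ_j|`. -/
def goeWeight (N : ℕ) (lam : Fin N → ℝ) : ℝ :=
  (∏ j : Fin N, Real.exp (-(lam j) ^ 2 / 2)) *
    ∏ j : Fin N, ∏ k ∈ Finset.Ioi j, |lam k - lam j|

/-- The normalisation constant `Z_{1,N}` of the GOE eigenvalue density. -/
def goeZ (N : ℕ) : ℝ := ∫ lam : Fin N → ℝ, goeWeight N lam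

/-- The box `(-∞, y)^N`. -/
def box (N : ℕ) (y : ℝ) : Set (Fin N → ℝ) := Set.univ.pi fun _ => Set.Iio y

/-- The integrand `∏_j a(λ_j) * ∏_j exp (-λ_j² / 2) * ∏_{j < k} |λ_k - λ_j|`. -/
def avgIntegrand {𝕜 : Type*} [RCLike 𝕜] (N : ℕ) (a : ℝ → 𝕜) (lam : Fin N → ℝ) : 𝕜 :=
  (∏ j : Fin N, a (lam j)) * (goeWeight N lam : 𝕜)

/-- The restricted GOE average of `∏_j a(λ_j)`: the integral over `(-∞, y)^N` against the
normalised eigenvalue density. -/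
def goeAverage {𝕜 : Type*} [RCLike 𝕜] (N : ℕ) (a : ℝ → 𝕜) (y : ℝ) : 𝕜 :=
  ((goeZ N : ℝ) : 𝕜)⁻¹ * ∫ lam in box N y, avgIntegrand N a lam

/-- The function `x ↦ a(x) exp (-x² / 2) p(x)`. -/
def weighted {𝕜 : Type*} [RCLike 𝕜] (a : ℝ → 𝕜) (p : ℝ[X]) (x : ℝ) : 𝕜 :=
  a x * ((Real.exp (-x ^ 2 / 2) : ℝ) : 𝕜) * ((p.eval x : ℝ) : 𝕜)

/-- The matrix entry
`½ ∫_{-∞}^y dx a(x) e^{-x²/2} p(x) ∫_{-∞}^y dz a(z) e^{-z²/2} q(z) sgn (z - x)`. -/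
def gammaOne {𝕜 : Type*} [RCLike 𝕜] (a : ℝ → 𝕜) (y : ℝ) (p q : ℝ[X]) : 𝕜 :=
  (1 / 2 : 𝕜) * ∫ x in Set.Iio y,
    weighted a p x * ∫ z in Set.Iio y, weighted a q z * ((Real.sign (z - x) : ℝ) : 𝕜)

end RestrictedGOE

end

/-! ### The Pfaffian of the matrix of signs of differences. -/

namespace RestrictedGOE

/-! This is de Bruijn's method. Since the `R j` are monic of degree `j`, the determinant of the
weighted polynomials at the points is the product of the weights times the Vandermonde determinant V
(`avgIntegrand_eq`). Writing |V| = V sgn V, the integrand becomes that determinant times sgn V.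

The combinatorial core is that, at distinct points, sgn V is the Pfaffian of the matrix sgn(x_k -
x_j) (`sum_sign_sub`). This makes sgn V a signed sum of products in which each factor involves only
two variables. Relabelling variables shows that all (2n)! terms have the same integral. Expanding
the determinant and applying Fubini then splits each integral into n double integrals
(`integral_det_mul_sign_vandermonde`), which are twice the entries γ. The resulting sum is a
Pfaffian, and the factors of two give 2^n. -/

/-- Three distinct indices cannot be mapped by a permutation into a block of size two. -/
theorem block_fst_ne {n : ℕ} (P : Equiv.Perm (Fin n × Fin 2)) {a b c : Fin n × Fin 2}
    (hab : a ≠ b) (hac : a ≠ c) (hbc : b ≠ c) (h : (P a).1 = (P b).1) : (P a).1 ≠ (P c).1 := by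
  intro h'
  have h1 : (P a).2 ≠ (P b).2 := fun q => hab (P.injective (Prod.ext h q))
  have h2 : (P a).2 ≠ (P c).2 := fun q => hac (P.injective (Prod.ext h' q))
  have h3 : (P b).2 ≠ (P c).2 := fun q => hbc (P.injective (Prod.ext (h.symm.trans h') q))
  omega

/-- The permutation `(i, b) ↦ (σ i, τ i b)` of `Fin n × Fin 2`. -/
def blockPerm {n : ℕ} (q : Equiv.Perm (Fin n) × (Fin n → Equiv.Perm (Fin 2))) :
    Equiv.Perm (Fin n × Fin 2) :=
  Equiv.prodCongrLeft (fun _ => q.1) * Equiv.prodCongrRight q.2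

theorem blockPerm_apply {n : ℕ} (q : Equiv.Perm (Fin n) × (Fin n → Equiv.Perm (Fin 2)))
    (i : Fin n) (b : Fin 2) : blockPerm q (i, b) = (q.1 i, q.2 i b) := rfl

theorem blockPerm_injective {n : ℕ} : Function.Injective (blockPerm (n := n)) := by
  intro q q' h
  have key : ∀ i b, (q.1 i, q.2 i b) = (q'.1 i, q'.2 i b) := fun i b => by
    rw [← blockPerm_apply, h, blockPerm_apply]
  refine Prod.ext (Equiv.ext fun i => congrArg Prod.fst (key i 0)) ?_
  funext i
  exact Equiv.ext fun b => congrArg Prod.snd (key i b)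

/-- The block permutation acts identically on both copies of `Fin n`, so its sign enters squared and
disappears. -/
theorem sign_blockPerm {n : ℕ} (q : Equiv.Perm (Fin n) × (Fin n → Equiv.Perm (Fin 2))) :
    Equiv.Perm.sign (blockPerm q) = ∏ i, Equiv.Perm.sign (q.2 i) := by
  rw [blockPerm, Equiv.Perm.sign_mul, Equiv.Perm.sign_prodCongrLeft,
    Equiv.Perm.sign_prodCongrRight]
  simp

theorem exists_blockPerm_eq {n : ℕ} (P : Equiv.Perm (Fin n × Fin 2))
    (hP : ∀ i, (P (i, 0)).1 = (P (i, 1)).1) : ∃ q, blockPerm q = P := by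
  have hP' : ∀ i b, (P (i, b)).1 = (P (i, 0)).1 := by
    intro i b
    fin_cases b
    · rfl
    · exact (hP i).symm
  have hσ : Function.Injective fun i => (P (i, 0)).1 := by
    intro i j hij
    by_contra hne
    exact block_fst_ne P (a := (i, 0)) (b := (i, 1)) (c := (j, 0)) (by simp)
      (by simpa using hne) (by simp) (hP i) hij
  have hτ : ∀ i, Function.Injective fun b => (P (i, b)).2 := by
    intro i b c hbc
    have := P.injective (Prod.ext ((hP' i b).trans (hP' i c).symm) hbc)
    exact congrArg Prod.snd this
  refine ⟨(Equiv.ofBijective _ (Finite.injective_iff_bijective.1 hσ),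
    fun i => Equiv.ofBijective _ (Finite.injective_iff_bijective.1 (hτ i))), ?_⟩
  refine Equiv.ext fun ⟨i, b⟩ => ?_
  rw [blockPerm_apply]
  exact Prod.ext (hP' i b).symm rfl

/-- The summand of the Pfaffian of the matrix of signs of differences. -/
noncomputable def pairSign {n : ℕ} (x : Fin n × Fin 2 → ℝ) (P : Equiv.Perm (Fin n × Fin 2)) : ℝ :=
  ((Equiv.Perm.sign P : ℤ) : ℝ) * ∏ i, Real.sign (x (P (i, 1)) - x (P (i, 0)))

theorem sign_sub_perm_two {x : Fin 2 → ℝ} (h : x 0 < x 1) (τ : Equiv.Perm (Fin 2)) :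
    Real.sign (x (τ 1) - x (τ 0)) = ((Equiv.Perm.sign τ : ℤ) : ℝ) := by
  have : τ = 1 ∨ τ = Equiv.swap 0 1 := by revert τ; decide
  rcases this with rfl | rfl
  · simp [Real.sign_of_pos (sub_pos.2 h)]
  · simp [Real.sign_of_neg (sub_neg.2 h)]

theorem pairSign_blockPerm {n : ℕ} {x : Fin n × Fin 2 → ℝ} (h2 : ∀ i, x (i, 0) < x (i, 1))
    (q : Equiv.Perm (Fin n) × (Fin n → Equiv.Perm (Fin 2))) : pairSign x (blockPerm q) = 1 := by
  have : ∀ i, Real.sign (x (blockPerm q (i, 1)) - x (blockPerm q (i, 0))) =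
      ((Equiv.Perm.sign (q.2 i) : ℤ) : ℝ) := fun i =>
    sign_sub_perm_two (x := fun b => x (q.1 i, b)) (h2 _) (q.2 i)
  rw [pairSign, Finset.prod_congr rfl fun i _ => this i, sign_blockPerm]
  push_cast
  rw [← Finset.prod_mul_distrib]
  refine Finset.prod_eq_one fun i _ => ?_
  rcases Int.units_eq_one_or (Equiv.Perm.sign (q.2 i)) with h | h <;> simp [h]

theorem swap_fst {n : ℕ} (k : Fin n) (u : Fin n × Fin 2) :
    (Equiv.swap (k, (0 : Fin 2)) (k, 1) u).1 = u.1 := by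
  rw [Equiv.swap_apply_def]
  split_ifs with h h <;> simp [h]

/-- Points in different blocks are ordered by their blocks, which the swap preserves; a pair inside
a block other than `k` is not moved at all. -/
theorem sign_sub_swap {n : ℕ} {x : Fin n × Fin 2 → ℝ} (h1 : ∀ u v, u.1 < v.1 → x u < x v)
    {k : Fin n} {u v : Fin n × Fin 2} (h : ¬(u.1 = k ∧ v.1 = k)) :
    Real.sign (x (Equiv.swap (k, 0) (k, 1) v) - x (Equiv.swap (k, 0) (k, 1) u)) =
      Real.sign (x v - x u) := by
  rcases lt_trichotomy u.1 v.1 with huv | huv | huv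
  · rw [Real.sign_of_pos (sub_pos.2 (h1 _ _ huv)),
      Real.sign_of_pos (sub_pos.2 (h1 _ _ (by simpa only [swap_fst] using huv)))]
  · have hu : u.1 ≠ k := fun q => h ⟨q, huv ▸ q⟩
    have hv : v.1 ≠ k := huv ▸ hu
    rw [Equiv.swap_apply_of_ne_of_ne, Equiv.swap_apply_of_ne_of_ne] <;>
      rintro rfl <;> simp at hu hv
  · rw [Real.sign_of_neg (sub_neg.2 (h1 _ _ huv)),
      Real.sign_of_neg (sub_neg.2 (h1 _ _ (by simpa only [swap_fst] using huv)))]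

/-- Permutations carrying pairs to blocks contribute 1 each, and there are 2^n n! of them. The
others cancel in twos: if some pair is split between blocks, exchanging the two elements of a block
it meets flips ε and preserves every sign factor. -/
theorem sum_pairSign_of_sorted {n : ℕ} {x : Fin n × Fin 2 → ℝ}
    (h1 : ∀ u v, u.1 < v.1 → x u < x v) (h2 : ∀ i, x (i, 0) < x (i, 1)) :
    ∑ P, pairSign x P = 2 ^ n * (n.factorial : ℝ) := by
  classical
  rw [← Finset.sum_filter_add_sum_filter_not Finset.univ
    (fun P : Equiv.Perm (Fin n × Fin 2) => ∀ i, (P (i, 0)).1 = (P (i, 1)).1)]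
  have good : (Finset.univ.filter
      fun P : Equiv.Perm (Fin n × Fin 2) => ∀ i, (P (i, 0)).1 = (P (i, 1)).1) =
      Finset.univ.image blockPerm := by
    ext P
    simp only [Finset.mem_filter, Finset.mem_univ, true_and, Finset.mem_image]
    refine ⟨exists_blockPerm_eq P, ?_⟩
    rintro ⟨q, rfl⟩ i
    rfl
  rw [good, Finset.sum_image (fun q _ q' _ h => blockPerm_injective h),
    Finset.sum_congr rfl fun q _ => pairSign_blockPerm h2 q]
  -- The split pair is chosen from the block map alone, not from the permutation. The swap leaves
  -- that map unchanged, so the same pair is chosen again and the operation is an involution.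
  have choice : ∀ f : Fin n × Fin 2 → Fin n, (¬∀ i, f (i, 0) = f (i, 1)) →
      ∃ i, f (i, 0) ≠ f (i, 1) := fun f h => not_forall.1 h
  choose c hc using choice
  have bad : ∑ P ∈ Finset.univ.filter
      (fun P : Equiv.Perm (Fin n × Fin 2) => ¬∀ i, (P (i, 0)).1 = (P (i, 1)).1),
      pairSign x P = 0 := by
    set s : ∀ P : Equiv.Perm (Fin n × Fin 2), (¬∀ i, (P (i, 0)).1 = (P (i, 1)).1) →
        Equiv.Perm (Fin n × Fin 2) := fun P h =>
      Equiv.swap ((P (c (fun u => (P u).1) h, 0)).1, 0) ((P (c (fun u => (P u).1) h, 0)).1, 1)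
      with hs
    have fst_eq : ∀ P h, (fun u => ((s P h * P) u).1) = fun u => (P u).1 := by
      intro P h
      funext u
      exact swap_fst _ _
    refine Finset.sum_involution (fun P hP => s P (Finset.mem_filter.1 hP).2 * P) ?_ ?_ ?_ ?_
    · intro P hP
      have hP' := (Finset.mem_filter.1 hP).2
      have hsign : ((Equiv.Perm.sign (s P hP' * P) : ℤ) : ℝ) =
          -((Equiv.Perm.sign P : ℤ) : ℝ) := by
        rw [Equiv.Perm.sign_mul, hs]
        simp only
        rw [Equiv.Perm.sign_swap (by simp)]
        simp
      have hprod : ∀ i, Real.sign (x ((s P hP' * P) (i, 1)) - x ((s P hP' * P) (i, 0))) =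
          Real.sign (x (P (i, 1)) - x (P (i, 0))) := by
        intro i
        refine sign_sub_swap h1 ?_
        rintro ⟨ha, hb⟩
        have hne := hc (fun u => (P u).1) hP'
        by_cases hi : i = c (fun u => (P u).1) hP'
        · rw [← hi] at hne hb
          exact hne hb.symm
        -- A second pair lying wholly in the swapped block would put three indices into a block of
        -- two.
        · exact block_fst_ne P (a := (i, 0)) (b := (i, 1)) (by simp) (by simpa using hi)
            (by simp) (ha.trans hb.symm) ha
      simp only [pairSign, hsign, hprod]
      ring
    · intro P hP _ h
      have h' := congrArg Equiv.Perm.sign h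
      rw [Equiv.Perm.sign_mul, hs] at h'
      simp only at h'
      rw [Equiv.Perm.sign_swap (by simp)] at h'
      rcases Int.units_eq_one_or (Equiv.Perm.sign P) with e | e <;> rw [e] at h' <;>
        revert h' <;> decide
    · intro P hP
      have hP' := (Finset.mem_filter.1 hP).2
      simp only [Finset.mem_filter, Finset.mem_univ, true_and]
      intro h
      apply hP'
      intro i
      have := h i
      rwa [congrFun (fst_eq P hP') (i, 0), congrFun (fst_eq P hP') (i, 1)] at this
    · intro P hP
      have hP' := (Finset.mem_filter.1 hP).2
      have : ∀ h, s (s P hP' * P) h = s P hP' := by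
        intro h
        have hcc : ∀ (f g : Fin n × Fin 2 → Fin n) (hf) (hg), f = g → c f hf = c g hg := by
          rintro f g hf hg rfl
          rfl
        have e1 : c (fun u => ((s P hP' * P) u).1) h = c (fun u => (P u).1) hP' :=
          hcc _ _ _ _ (fst_eq P hP')
        have e2 : ((s P hP' * P) (c (fun u => ((s P hP' * P) u).1) h, 0)).1 =
            (P (c (fun u => (P u).1) hP', 0)).1 := by
          rw [e1]
          exact congrFun (fst_eq P hP') _
        change Equiv.swap (_, _) (_, _) = Equiv.swap (_, _) (_, _)
        rw [e2]
      simp only [this]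
      rw [← mul_assoc, hs]
      simp only [Equiv.swap_mul_self, one_mul]
  rw [bad]
  simp [Fintype.card_perm, mul_comm]

/-- The splitting of `2n` indices into `n` consecutive pairs. -/
def pairEquiv (n : ℕ) : Fin n × Fin 2 ≃ Fin (2 * n) :=
  finProdFinEquiv.trans (finCongr (mul_comm n 2))

theorem pairEquiv_zero {n : ℕ} (i : Fin n) : pairEquiv n (i, 0) = ⟨2 * (i : ℕ), by omega⟩ := by
  ext
  simp [pairEquiv]

theorem pairEquiv_one {n : ℕ} (i : Fin n) :
    pairEquiv n (i, 1) = ⟨2 * (i : ℕ) + 1, by omega⟩ := by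
  ext
  simp [pairEquiv, add_comm]

/-- Sorting the points reduces to the increasing case, where V > 0; both sides pick up the sign of
the sorting permutation. -/
theorem sum_sign_sub {n : ℕ} (x : Fin (2 * n) → ℝ) (hx : Function.Injective x) :
    ∑ P : Equiv.Perm (Fin (2 * n)), ((Equiv.Perm.sign P : ℤ) : ℝ) *
        ∏ i : Fin n, Real.sign (x (P (pairEquiv n (i, 1))) - x (P (pairEquiv n (i, 0)))) =
      2 ^ n * (n.factorial : ℝ) * Real.sign (Matrix.vandermonde x).det := by
  have sorted : ∀ x : Fin (2 * n) → ℝ, StrictMono x →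
      ∑ P : Equiv.Perm (Fin (2 * n)), ((Equiv.Perm.sign P : ℤ) : ℝ) *
        ∏ i : Fin n, Real.sign (x (P (pairEquiv n (i, 1))) - x (P (pairEquiv n (i, 0)))) =
      2 ^ n * (n.factorial : ℝ) := by
    intro x hx
    rw [← sum_pairSign_of_sorted (x := x ∘ pairEquiv n),
      ← Equiv.sum_comp (pairEquiv n).permCongr]
    · refine Finset.sum_congr rfl fun P _ => ?_
      rw [Equiv.Perm.sign_permCongr, pairSign]
      simp [Equiv.permCongr_apply]
    · rintro ⟨i, b⟩ ⟨j, c⟩ h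
      refine hx (Fin.lt_def.2 ?_)
      have h' : (i : ℕ) < j := h
      simp only [pairEquiv, Equiv.trans_apply, finCongr_apply, Fin.val_cast,
        finProdFinEquiv_apply_val]
      omega
    · intro i
      refine hx (Fin.lt_def.2 ?_)
      rw [pairEquiv_zero, pairEquiv_one]
      simp
  set π := Tuple.sort x
  have hmono : StrictMono (x ∘ π) :=
    (Tuple.monotone_sort x).strictMono_of_injective (hx.comp π.injective)
  have hpos : 0 < (Matrix.vandermonde (x ∘ π)).det := by
    rw [Matrix.det_vandermonde]
    exact Finset.prod_pos fun i _ => Finset.prod_pos fun j hj =>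
      sub_pos.2 (hmono (Finset.mem_Ioi.1 hj))
  have hdet : (Matrix.vandermonde (x ∘ π)).det =
      ((Equiv.Perm.sign π : ℤ) : ℝ) * (Matrix.vandermonde x).det :=
    Matrix.det_permute π (Matrix.vandermonde x)
  have hs := sorted _ hmono
  rw [← Equiv.sum_comp (Equiv.mulLeft π)]
  simp only [Equiv.coe_mulLeft, Equiv.Perm.sign_mul, Equiv.Perm.mul_apply, Units.val_mul,
    Int.cast_mul, mul_assoc]
  rw [← Finset.mul_sum]
  simp only [Function.comp_apply] at hs
  rw [hs]
  rcases Int.units_eq_one_or (Equiv.Perm.sign π) with h | h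
  · rw [h] at hdet ⊢
    rw [Real.sign_of_pos (by simpa [hdet] using hpos)]
    simp
  · rw [h] at hdet ⊢
    rw [Real.sign_of_neg (by simpa [hdet] using hpos)]
    simp

end RestrictedGOE

/-! ### Bounded sign factors and measure-preserving rearrangements. -/

namespace RestrictedGOE

variable {𝕜 : Type*} [RCLike 𝕜]

theorem measurable_real_sign : Measurable Real.sign := by
  unfold Real.sign
  exact Measurable.ite measurableSet_Iio measurable_const
    (Measurable.ite measurableSet_Ioi measurable_const measurable_const)

theorem abs_real_sign_le_one (r : ℝ) : |Real.sign r| ≤ 1 := by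
  rcases Real.sign_apply_eq r with h | h | h <;> simp [h]

theorem abs_prod_real_sign_le_one {ι : Type*} (s : Finset ι) (f : ι → ℝ) :
    |∏ i ∈ s, Real.sign (f i)| ≤ 1 := by
  rw [Finset.abs_prod]
  exact Finset.prod_le_one (fun _ _ => abs_nonneg _) fun _ _ => abs_real_sign_le_one _

theorem mul_real_sign_self (r : ℝ) : r * Real.sign r = |r| := by
  rcases lt_trichotomy r 0 with h | rfl | h
  · rw [Real.sign_of_neg h, abs_of_neg h, mul_neg_one]
  · simp
  · rw [Real.sign_of_pos h, abs_of_pos h, mul_one]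

/-- Multiplication by a measurable real function bounded by one preserves integrability. -/
theorem integrable_mul_ofReal {α : Type*} [MeasurableSpace α] {μ : Measure α} {f : α → 𝕜}
    (hf : Integrable f μ) {s : α → ℝ} (hs : Measurable s) (hb : ∀ x, |s x| ≤ 1) :
    Integrable (fun x => f x * ((s x : ℝ) : 𝕜)) μ := by
  refine hf.mul_bdd (c := 1) (RCLike.measurable_ofReal.comp hs).aestronglyMeasurable
    (Filter.Eventually.of_forall fun x => ?_)
  rw [RCLike.norm_ofReal]
  exact hb x

theorem measurePreserving_comp_perm {ι : Type*} [Fintype ι] (μ : Measure ℝ) [SigmaFinite μ]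
    (P : Equiv.Perm ι) :
    MeasurePreserving (fun x : ι → ℝ => x ∘ P) (Measure.pi fun _ => μ)
      (Measure.pi fun _ => μ) := by
  have hm : Measurable fun x : ι → ℝ => x ∘ P :=
    measurable_pi_lambda _ fun i => measurable_pi_apply (P i)
  refine ⟨hm, (Measure.pi_eq fun s hs => ?_).symm⟩
  have : (fun x : ι → ℝ => x ∘ P) ⁻¹' Set.univ.pi s = Set.univ.pi fun i => s (P.symm i) := by
    ext x
    simp only [Set.mem_preimage, Set.mem_univ_pi, Function.comp_apply]
    exact ⟨fun h i => by simpa using h (P.symm i), fun h i => by simpa using h (P i)⟩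
  rw [Measure.map_apply hm (MeasurableSet.univ_pi hs), this, Measure.pi_pi]
  exact Equiv.prod_comp P.symm fun i => μ (s i)

/-- The vector whose consecutive pairs of coordinates are the given points of the plane. -/
def unpair {n : ℕ} (p : Fin n → ℝ × ℝ) (k : Fin (2 * n)) : ℝ :=
  if ((pairEquiv n).symm k).2 = 0 then (p ((pairEquiv n).symm k).1).1
  else (p ((pairEquiv n).symm k).1).2

theorem unpair_zero {n : ℕ} (p : Fin n → ℝ × ℝ) (i : Fin n) :
    unpair p (pairEquiv n (i, 0)) = (p i).1 := by
  simp [unpair]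

theorem unpair_one {n : ℕ} (p : Fin n → ℝ × ℝ) (i : Fin n) :
    unpair p (pairEquiv n (i, 1)) = (p i).2 := by
  simp [unpair]

theorem prod_pairs {M : Type*} [CommMonoid M] {n : ℕ} (f : Fin (2 * n) → M) :
    ∏ k, f k = ∏ i : Fin n, f (pairEquiv n (i, 0)) * f (pairEquiv n (i, 1)) := by
  rw [← Equiv.prod_comp (pairEquiv n), Fintype.prod_prod_type]
  simp only [Fin.prod_univ_two]

theorem measurePreserving_unpair {n : ℕ} (μ : Measure ℝ) [SigmaFinite μ] :
    MeasurePreserving (unpair (n := n)) (Measure.pi fun _ => μ.prod μ)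
      (Measure.pi fun _ => μ) := by
  have hm : Measurable (unpair (n := n)) := by
    refine measurable_pi_lambda _ fun k => ?_
    unfold unpair
    split_ifs
    · exact (measurable_pi_apply _).fst
    · exact (measurable_pi_apply _).snd
  refine ⟨hm, (Measure.pi_eq fun s hs => ?_).symm⟩
  have : unpair ⁻¹' Set.univ.pi s =
      Set.univ.pi fun i => s (pairEquiv n (i, 0)) ×ˢ s (pairEquiv n (i, 1)) := by
    ext p
    simp only [Set.mem_preimage, Set.mem_univ_pi, Set.mem_prod]
    rw [← (pairEquiv n).forall_congr_right, Prod.forall]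
    simp only [Fin.forall_fin_two, unpair_zero, unpair_one]
  rw [Measure.map_apply hm (MeasurableSet.univ_pi hs), this, Measure.pi_pi, prod_pairs]
  simp only [Measure.prod_prod]

/-! ### Integrating determinants against the sign of the Vandermonde determinant. -/

/-- The matrix of values of the functions `φ j` at the points `x i`. -/
def evalMatrix {N : ℕ} (φ : Fin N → ℝ → 𝕜) (x : Fin N → ℝ) : Matrix (Fin N) (Fin N) 𝕜 :=
  Matrix.of fun i j => φ j (x i)

theorem det_evalMatrix {N : ℕ} (φ : Fin N → ℝ → 𝕜) (x : Fin N → ℝ) :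
    (evalMatrix φ x).det =
      ∑ P : Equiv.Perm (Fin N), ((Equiv.Perm.sign P : ℤ) : 𝕜) * ∏ i, φ (P i) (x i) := by
  rw [← Matrix.det_transpose, Matrix.det_apply']
  rfl

theorem det_evalMatrix_comp_perm {N : ℕ} (φ : Fin N → ℝ → 𝕜) (x : Fin N → ℝ)
    (P : Equiv.Perm (Fin N)) :
    (evalMatrix φ (x ∘ P)).det = ((Equiv.Perm.sign P : ℤ) : 𝕜) * (evalMatrix φ x).det :=
  Matrix.det_permute P (evalMatrix φ x)

theorem det_evalMatrix_of_not_injective {N : ℕ} (φ : Fin N → ℝ → 𝕜) {x : Fin N → ℝ}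
    (hx : ¬Function.Injective x) : (evalMatrix φ x).det = 0 := by
  obtain ⟨i, j, hij, hne⟩ := Function.not_injective_iff.1 hx
  refine Matrix.det_zero_of_row_eq hne ?_
  funext k
  simp [evalMatrix, hij]

theorem integrable_det_evalMatrix {N : ℕ} (μ : Measure ℝ) [SigmaFinite μ] {φ : Fin N → ℝ → 𝕜}
    (hφ : ∀ j, Integrable (φ j) μ) :
    Integrable (fun x => (evalMatrix φ x).det) (Measure.pi fun _ => μ) := by
  simp only [det_evalMatrix]
  exact integrable_finsetSum _ fun P _ =>
    (Integrable.fintype_prod fun i => hφ (P i)).const_mul _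

theorem measurable_det_vandermonde {N : ℕ} :
    Measurable fun x : Fin N → ℝ => (Matrix.vandermonde x).det := by
  simp only [Matrix.det_vandermonde]
  fun_prop

/-- The product of the signs of the differences within consecutive pairs of `x ∘ P`. -/
noncomputable def pairSigns {n : ℕ} (P : Equiv.Perm (Fin (2 * n))) (x : Fin (2 * n) → ℝ) : ℝ :=
  ∏ i : Fin n, Real.sign (x (P (pairEquiv n (i, 1))) - x (P (pairEquiv n (i, 0))))

theorem measurable_pairSigns {n : ℕ} (P : Equiv.Perm (Fin (2 * n))) :
    Measurable (pairSigns P) := by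
  refine Finset.measurable_prod _ fun i _ => measurable_real_sign.comp ?_
  fun_prop

theorem abs_pairSigns_le_one {n : ℕ} (P : Equiv.Perm (Fin (2 * n))) (x : Fin (2 * n) → ℝ) :
    |pairSigns P x| ≤ 1 :=
  abs_prod_real_sign_le_one _ _

/-- Each ε(P) of the Pfaffian expansion is absorbed by permuting the rows of the determinant, so the
terms differ only by relabelling `x`. With coinciding points the sign identity is not needed: two
equal rows make both sides vanish. -/
theorem det_mul_sign_vandermonde {n : ℕ} (φ : Fin (2 * n) → ℝ → 𝕜) (x : Fin (2 * n) → ℝ) :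
    (evalMatrix φ x).det * ((Real.sign (Matrix.vandermonde x).det : ℝ) : 𝕜) =
      (2 ^ n * (n.factorial : 𝕜))⁻¹ * ∑ P : Equiv.Perm (Fin (2 * n)),
        (evalMatrix φ (x ∘ P)).det * ((pairSigns 1 (x ∘ P) : ℝ) : 𝕜) := by
  by_cases hx : Function.Injective x
  · have h := congrArg (fun r : ℝ => (r : 𝕜)) (sum_sign_sub x hx)
    push_cast at h
    have h0 : (2 ^ n * (n.factorial : 𝕜)) ≠ 0 :=
      mul_ne_zero (pow_ne_zero _ two_ne_zero) (Nat.cast_ne_zero.2 n.factorial_ne_zero)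
    rw [eq_inv_mul_iff_mul_eq₀ h0, mul_left_comm, ← h, Finset.mul_sum]
    refine Finset.sum_congr rfl fun P _ => ?_
    rw [det_evalMatrix_comp_perm, pairSigns]
    push_cast
    simp only [id_eq, Function.comp_apply]
    ring
  · rw [det_evalMatrix_of_not_injective φ hx, Finset.sum_eq_zero]
    · simp
    · intro P _
      rw [det_evalMatrix_comp_perm, det_evalMatrix_of_not_injective φ hx]
      simp

theorem integral_prod_mul_pairSigns {n : ℕ} (μ : Measure ℝ) [SigmaFinite μ]
    {ψ : Fin (2 * n) → ℝ → 𝕜} (hψ : ∀ j, Integrable (ψ j) μ) :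
    ∫ x, (∏ i, ψ i (x i)) * ((pairSigns 1 x : ℝ) : 𝕜) ∂(Measure.pi fun _ => μ) =
      ∏ i : Fin n, ∫ p : ℝ × ℝ, ψ (pairEquiv n (i, 0)) p.1 *
        (ψ (pairEquiv n (i, 1)) p.2 * ((Real.sign (p.2 - p.1) : ℝ) : 𝕜)) ∂(μ.prod μ) := by
  have hint := integrable_mul_ofReal (Integrable.fintype_prod hψ) (measurable_pairSigns 1)
    (abs_pairSigns_le_one 1)
  have hu := measurePreserving_unpair (n := n) μ
  rw [← hu.map_eq, integral_map hu.measurable.aemeasurable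
    (by rw [hu.map_eq]; exact hint.aestronglyMeasurable), ← integral_fintype_prod_eq_prod]
  refine integral_congr_ae (Filter.Eventually.of_forall fun p => ?_)
  simp only [pairSigns, prod_pairs, Equiv.Perm.one_apply, unpair_zero, unpair_one]
  push_cast
  rw [← Finset.prod_mul_distrib]
  simp only [mul_assoc]

/-- De Bruijn's integration formula for determinants integrated against the sign of the
Vandermonde determinant. -/
theorem integral_det_mul_sign_vandermonde {n : ℕ} (μ : Measure ℝ) [SigmaFinite μ]
    {φ : Fin (2 * n) → ℝ → 𝕜} (hφ : ∀ j, Integrable (φ j) μ) :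
    ∫ x, (evalMatrix φ x).det * ((Real.sign (Matrix.vandermonde x).det : ℝ) : 𝕜)
        ∂(Measure.pi fun _ => μ) =
      (2 ^ n * (n.factorial : 𝕜))⁻¹ * ((2 * n).factorial *
        ∑ P : Equiv.Perm (Fin (2 * n)), ((Equiv.Perm.sign P : ℤ) : 𝕜) *
          ∏ i : Fin n, ∫ p : ℝ × ℝ, φ (P (pairEquiv n (i, 0))) p.1 *
            (φ (P (pairEquiv n (i, 1))) p.2 * ((Real.sign (p.2 - p.1) : ℝ) : 𝕜))
              ∂(μ.prod μ)) := by
  have hF := integrable_mul_ofReal (integrable_det_evalMatrix μ hφ) (measurable_pairSigns 1)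
    (abs_pairSigns_le_one 1)
  have hperm : ∀ P : Equiv.Perm (Fin (2 * n)),
      ∫ x, (evalMatrix φ (x ∘ P)).det * ((pairSigns 1 (x ∘ P) : ℝ) : 𝕜)
        ∂(Measure.pi fun _ => μ) =
      ∫ x, (evalMatrix φ x).det * ((pairSigns 1 x : ℝ) : 𝕜) ∂(Measure.pi fun _ => μ) := by
    intro P
    have hP := measurePreserving_comp_perm μ P
    conv_rhs => rw [← hP.map_eq]
    rw [integral_map hP.measurable.aemeasurable
      (by rw [hP.map_eq]; exact hF.aestronglyMeasurable)]
  simp only [det_mul_sign_vandermonde]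
  have hFP : ∀ P : Equiv.Perm (Fin (2 * n)),
      Integrable (fun x => (evalMatrix φ (x ∘ P)).det * ((pairSigns 1 (x ∘ P) : ℝ) : 𝕜))
        (Measure.pi fun _ => μ) := fun P =>
    (measurePreserving_comp_perm μ P).integrable_comp_of_integrable hF
  rw [integral_const_mul, integral_finsetSum _ fun P _ => hFP P]
  -- All terms being equal, the sum over P yields the factor (2n)!.
  simp only [hperm, Finset.sum_const, Finset.card_univ, Fintype.card_perm, Fintype.card_fin,
    nsmul_eq_mul]
  congr 2
  have expand : ∀ x : Fin (2 * n) → ℝ, (evalMatrix φ x).det * ((pairSigns 1 x : ℝ) : 𝕜) =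
      ∑ P : Equiv.Perm (Fin (2 * n)), ((Equiv.Perm.sign P : ℤ) : 𝕜) *
        ((∏ i, φ (P i) (x i)) * ((pairSigns 1 x : ℝ) : 𝕜)) := by
    intro x
    rw [det_evalMatrix, Finset.sum_mul]
    simp only [mul_assoc]
  simp only [expand]
  rw [integral_finsetSum _ fun P _ => (integrable_mul_ofReal
    (Integrable.fintype_prod fun i => hφ (P i)) (measurable_pairSigns 1)
      (abs_pairSigns_le_one 1)).const_mul _]
  refine Finset.sum_congr rfl fun P _ => ?_
  rw [integral_const_mul, integral_prod_mul_pairSigns μ fun i => hφ (P i)]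

/-! ### The GOE density, its normalisation and the matrix entries. -/

theorem integrable_weighted {μ : Measure ℝ} {a : ℝ → 𝕜} {N : ℕ}
    (ha : ∀ k < N, Integrable
      (fun x : ℝ => a x * ((Real.exp (-x ^ 2 / 2) : ℝ) : 𝕜) * ((x ^ k : ℝ) : 𝕜)) μ)
    {p : ℝ[X]} (hp : p.natDegree < N) : Integrable (weighted a p) μ := by
  have : weighted a p = fun x : ℝ => ∑ k ∈ Finset.range N, ((p.coeff k : ℝ) : 𝕜) *
      (a x * ((Real.exp (-x ^ 2 / 2) : ℝ) : 𝕜) * ((x ^ k : ℝ) : 𝕜)) := by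
    funext x
    rw [weighted, Polynomial.eval_eq_sum_range' hp]
    push_cast
    rw [Finset.mul_sum]
    exact Finset.sum_congr rfl fun k _ => by ring
  rw [this]
  exact integrable_finsetSum _ fun k hk => (ha k (Finset.mem_range.1 hk)).const_mul _

theorem avgIntegrand_eq {N : ℕ} (a : ℝ → 𝕜) (R : ℕ → ℝ[X])
    (hR : ∀ j < N, (R j).Monic ∧ (R j).natDegree = j) (x : Fin N → ℝ) :
    avgIntegrand N a x = (evalMatrix (fun j : Fin N => weighted a (R j)) x).det *
      ((Real.sign (Matrix.vandermonde x).det : ℝ) : 𝕜) := by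
  have hV := Matrix.det_eval_matrixOfPolynomials_eq_det_vandermonde x
    (fun j : Fin N => R j) (fun j => (hR j j.2).2) (fun j => (hR j j.2).1)
  have h1 : (evalMatrix (fun j : Fin N => weighted a (R j)) x).det =
      (∏ i, a (x i) * ((Real.exp (-(x i) ^ 2 / 2) : ℝ) : 𝕜)) *
        (((Matrix.vandermonde x).det : ℝ) : 𝕜) := by
    have h2 : (((Matrix.vandermonde x).det : ℝ) : 𝕜) =
        ((Matrix.of fun i j : Fin N => (R j).eval (x i)).map (algebraMap ℝ 𝕜)).det := by
      rw [hV]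
      exact RingHom.map_det (algebraMap ℝ 𝕜) _
    rw [h2, ← Matrix.det_mul_column]
    rfl
  have habs : ∏ j : Fin N, ∏ k ∈ Finset.Ioi j, |x k - x j| = |(Matrix.vandermonde x).det| := by
    rw [Matrix.det_vandermonde, Finset.abs_prod]
    simp only [Finset.abs_prod]
  rw [h1, avgIntegrand, goeWeight, habs, ← mul_real_sign_self, Finset.prod_mul_distrib]
  push_cast
  ring

/-- The monomials serve as the monic family, so the moment hypotheses suffice. -/
theorem integrable_avgIntegrand {N : ℕ} (μ : Measure ℝ) [SigmaFinite μ] {a : ℝ → 𝕜}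
    (ha : ∀ k < N, Integrable
      (fun x : ℝ => a x * ((Real.exp (-x ^ 2 / 2) : ℝ) : 𝕜) * ((x ^ k : ℝ) : 𝕜)) μ) :
    Integrable (avgIntegrand N a) (Measure.pi fun _ => μ) := by
  have hR : ∀ j < N, (X ^ j : ℝ[X]).Monic ∧ (X ^ j : ℝ[X]).natDegree = j := fun j _ =>
    ⟨monic_X_pow j, natDegree_X_pow j⟩
  have : avgIntegrand N a = fun x => (evalMatrix (fun j : Fin N => weighted a (X ^ (j : ℕ))) x).det
      * ((Real.sign (Matrix.vandermonde x).det : ℝ) : 𝕜) :=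
    funext (avgIntegrand_eq a (fun j => X ^ j) hR)
  rw [this]
  refine integrable_mul_ofReal (integrable_det_evalMatrix μ fun j => integrable_weighted ha ?_)
    (measurable_real_sign.comp measurable_det_vandermonde) fun x => abs_real_sign_le_one _
  rw [natDegree_X_pow]
  exact j.2

theorem integrable_goeWeight (N : ℕ) : Integrable (goeWeight N) := by
  have h := integrable_avgIntegrand (N := N) (volume : Measure ℝ) (a := fun _ => (1 : ℝ)) ?_
  · have e : avgIntegrand N (fun _ => (1 : ℝ)) = goeWeight N := by
      funext x
      simp [avgIntegrand]
    rwa [e] at h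
  · intro k _
    have := integrable_rpow_mul_exp_neg_mul_sq (b := 1 / 2) (by norm_num) (s := k)
      (by linarith [k.cast_nonneg (α := ℝ)])
    refine this.congr (Filter.Eventually.of_forall fun x => ?_)
    simp only [Real.rpow_natCast, RCLike.ofReal_real_eq_id, id_eq, one_mul]
    rw [mul_comm]
    congr 2
    ring

theorem goeZ_pos (N : ℕ) : 0 < goeZ N := by
  -- The density is continuous and nonnegative, and nonzero at the distinct points 0, 1, ..., N - 1.
  refine integral_pos_of_integrable_nonneg_nonzero (x := fun i : Fin N => ((i : ℕ) : ℝ)) ?_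
    (integrable_goeWeight N) ?_ ?_
  · unfold goeWeight
    fun_prop
  · intro x
    exact mul_nonneg (Finset.prod_nonneg fun _ _ => (Real.exp_pos _).le)
      (Finset.prod_nonneg fun _ _ => Finset.prod_nonneg fun _ _ => abs_nonneg _)
  · refine (mul_pos (Finset.prod_pos fun _ _ => Real.exp_pos _)
      (Finset.prod_pos fun i _ => Finset.prod_pos fun j hj => abs_pos.2 ?_)).ne'
    have : (i : ℕ) < j := Fin.lt_def.1 (Finset.mem_Ioi.1 hj)
    exact (sub_pos.2 (Nat.cast_lt.2 this)).ne'

theorem integrable_weighted_mul_sign {μ : Measure ℝ} [SigmaFinite μ] {f g : ℝ → 𝕜}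
    (hf : Integrable f μ) (hg : Integrable g μ) :
    Integrable (fun p : ℝ × ℝ => f p.1 * (g p.2 * ((Real.sign (p.2 - p.1) : ℝ) : 𝕜)))
      (μ.prod μ) := by
  simp only [← mul_assoc]
  exact integrable_mul_ofReal (hf.mul_prod hg)
    (measurable_real_sign.comp (measurable_snd.sub measurable_fst)) fun p =>
      abs_real_sign_le_one _

theorem gammaOne_eq {a : ℝ → 𝕜} {y : ℝ} {p q : ℝ[X]}
    (hp : IntegrableOn (weighted a p) (Set.Iio y))
    (hq : IntegrableOn (weighted a q) (Set.Iio y)) :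
    gammaOne a y p q = (1 / 2 : 𝕜) * ∫ u : ℝ × ℝ, weighted a p u.1 *
      (weighted a q u.2 * ((Real.sign (u.2 - u.1) : ℝ) : 𝕜))
        ∂((volume.restrict (Set.Iio y)).prod (volume.restrict (Set.Iio y))) := by
  rw [integral_prod _ (integrable_weighted_mul_sign hp hq), gammaOne]
  simp only [integral_const_mul]

end RestrictedGOE

/-- Here the (even) number of eigenvalues is `N = 2n`. -/
theorem mainTheorem6 {𝕜 : Type*} [RCLike 𝕜] (n : ℕ) (y : ℝ) (a : ℝ → 𝕜)
    (ha : ∀ k < 2 * n, IntegrableOn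
      (fun x : ℝ => a x * ((Real.exp (-x ^ 2 / 2) : ℝ) : 𝕜) * ((x ^ k : ℝ) : 𝕜)) (Set.Iio y))
    (R : ℕ → ℝ[X])
    (hR : ∀ j < 2 * n, (R j).Monic ∧ (R j).natDegree = j) :
    0 < RestrictedGOE.goeZ (2 * n) ∧
    IntegrableOn (RestrictedGOE.avgIntegrand (2 * n) a) (RestrictedGOE.box (2 * n) y) ∧
    (∀ j < 2 * n, ∀ k < 2 * n, IntegrableOn
      (fun p : ℝ × ℝ => RestrictedGOE.weighted a (R j) p.1 *
        (RestrictedGOE.weighted a (R k) p.2 * ((Real.sign (p.2 - p.1) : ℝ) : 𝕜)))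
      (Set.Iio y ×ˢ Set.Iio y)) ∧
    RestrictedGOE.goeAverage (2 * n) a y =
      (2 ^ n * ((2 * n).factorial : 𝕜)) / ((RestrictedGOE.goeZ (2 * n) : ℝ) : 𝕜) *
        RestrictedGOE.pfaffian (Matrix.of fun j k : Fin (2 * n) =>
          RestrictedGOE.gammaOne a y (R j) (R k)) := by
  have hbox : (volume : Measure (Fin (2 * n) → ℝ)).restrict (RestrictedGOE.box (2 * n) y) =
      Measure.pi fun _ => volume.restrict (Set.Iio y) :=
    Measure.restrict_pi_pi _ _
  have hw : ∀ j < 2 * n, IntegrableOn (RestrictedGOE.weighted a (R j)) (Set.Iio y) :=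
    fun j hj => RestrictedGOE.integrable_weighted ha ((hR j hj).2.trans_lt hj)
  refine ⟨RestrictedGOE.goeZ_pos _, ?_, ?_, ?_⟩
  · rw [IntegrableOn, hbox]
    exact RestrictedGOE.integrable_avgIntegrand _ ha
  · intro j hj k hk
    rw [IntegrableOn, Measure.volume_eq_prod, ← Measure.prod_restrict]
    exact RestrictedGOE.integrable_weighted_mul_sign (hw j hj) (hw k hk)
  · rw [RestrictedGOE.goeAverage, hbox]
    simp only [RestrictedGOE.avgIntegrand_eq a R hR]
    rw [RestrictedGOE.integral_det_mul_sign_vandermonde _ fun j : Fin (2 * n) => hw j j.2,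
      RestrictedGOE.pfaffian]
    have hγ : ∀ (P : Equiv.Perm (Fin (2 * n))), ∏ i : Fin n,
        (Matrix.of fun j k : Fin (2 * n) => RestrictedGOE.gammaOne a y (R j) (R k))
          (P ⟨2 * (i : ℕ), by omega⟩) (P ⟨2 * (i : ℕ) + 1, by omega⟩) =
        (1 / 2 : 𝕜) ^ n * ∏ i : Fin n, ∫ p : ℝ × ℝ,
          RestrictedGOE.weighted a (R (P (RestrictedGOE.pairEquiv n (i, 0)))) p.1 *
            (RestrictedGOE.weighted a (R (P (RestrictedGOE.pairEquiv n (i, 1)))) p.2 *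
              ((Real.sign (p.2 - p.1) : ℝ) : 𝕜))
            ∂((volume.restrict (Set.Iio y)).prod (volume.restrict (Set.Iio y))) := by
      intro P
      simp only [Matrix.of_apply, RestrictedGOE.pairEquiv_zero, RestrictedGOE.pairEquiv_one]
      rw [Finset.prod_congr rfl fun i _ =>
        RestrictedGOE.gammaOne_eq (hw _ (Fin.is_lt _)) (hw _ (Fin.is_lt _)),
        Finset.prod_mul_distrib, Finset.prod_const, Finset.card_univ, Fintype.card_fin]
    -- The n prefactors 1/2 of the entries come out as (1/2)^n, which the 2^n of the statement
    -- cancels.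
    simp only [hγ, mul_left_comm _ ((1 / 2 : 𝕜) ^ n), ← Finset.mul_sum]
    have h2 : (2 : 𝕜) ^ n * (1 / 2) ^ n = 1 := by
      rw [← mul_pow]
      norm_num
    rw [div_eq_mul_inv]
    linear_combination -((2 * n).factorial : 𝕜) *
      ((RestrictedGOE.goeZ (2 * n) : ℝ) : 𝕜)⁻¹ * (2 ^ n * (n.factorial : 𝕜))⁻¹ *
      (∑ P : Equiv.Perm (Fin (2 * n)), ((Equiv.Perm.sign P : ℤ) : 𝕜) *
        ∏ i : Fin n, ∫ p : ℝ × ℝ,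
          RestrictedGOE.weighted a (R (P (RestrictedGOE.pairEquiv n (i, 0)))) p.1 *
            (RestrictedGOE.weighted a (R (P (RestrictedGOE.pairEquiv n (i, 1)))) p.2 *
              ((Real.sign (p.2 - p.1) : ℝ) : 𝕜))
            ∂((volume.restrict (Set.Iio y)).prod (volume.restrict (Set.Iio y)))) * h2
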